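/- Let $\mathbb K$ be the ordered field of generalized dual Puiseux series: formal series $\sum_k \alpha_k t^{r_k}$ with real coefficients whose exponents form a (finite or infinite) strictly decreasing sequence of reals without finite accumulation point, where a series is positive if its leading coefficient is positive. For $0\ne \mathbf x\in\mathbb K$ let $\operatorname{val}^*(\mathbf x)\in\mathbb R$ be the highest exponent of $\mathbf x$; apply $\operatorname{val}^*$ coordinatewise to vectors. Put $$\mathcal H=\{x\in\mathbb R^n: x_1+\cdots+x_n=0\},\qquad \boldsymbol{\mathcal H}=\{\mathbf x\in\mathbb K_{>0}^n:\mathbf x_1\cdots\mathbf x_n=1\}.$$ For $a,b\in\mathbb R^n$ let $d_\triangle(a,b)=\sum_i(b_i-a_i)+n\max_i(a_i-b_i)$. For $S\subset\mathcal H$ and $a\in S$ the asymmetric tropical Voronoi region is $$\mathrm{VR}_S(a)=\{x\in\mathcal H: d_\triangle(x,a)\le d_\triangle(x,b)\text{ for all }b\in S\}.$$ For $\mathbf S\subset\mathbb K^n$ and $\mathbf a\in\mathbf S$ the farthest power region with weight function $w(\mathbf a)=\|\mathbf a\|^2=\sum_i\mathbf a_i^2$ is $$\mathrm{PR}_{\mathbf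 S}(\mathbf a)=\{\mathbf x\in\mathbb K_{\ge0}^n:\|\mathbf x-\mathbf a\|^2-\|\mathbf a\|^2\ \ge\ \|\mathbf x-\mathbf b\|^2-\|\mathbf b\|^2\text{ for all }\mathbf b\in\mathbf S\}.$$ Let $\mathrm{VD}(S)$ and $\mathrm{PD}(\mathbf S)$ be the sets of all intersections of nonempty families of Voronoi regions of $S$ and of farthest power regions of $\mathbf S$, respectively, each partially ordered by inclusion. **Theorem.** Let $S\subset\mathcal H$ be nonempty, super-discrete (for every $i$ the projection of $S$ to the $i$-th coordinate is a discrete subset of $\mathbb R$) and in general position (any two distinct $a,b\in S$ satisfy $a_i\neq b_i$ for all $i$). Let $\mathbf S\subset\boldsymbol{\mathcal H}$ be such that $\operatorname{val}^*$ restricts to a bijection from $\mathbf S$ onto $-S$. Then: 1. For every $\mathbf a\in\mathbf S$, with corresponding site $a=-\operatorname{val}^*(\mathbf a)\in S$, the map $\operatorname{val}^*$ sends $\mathrm{PR}_{\mathbf S}(\mathbf a)$ onto $\mathrm{VR}_S(a)$, in the sense that $$\operatorname{val}^*\bigl(\mathrm{PR}_{\mathbf S}(\mathbf a)\cap\boldsymbol{\mathcal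 H}\bigr)=\mathrm{VR}_S(a)\quad\text{and}\quad \operatorname{val}^*\bigl(\mathrm{PR}_{\mathbf S}(\mathbf a)\cap\mathbb K_{>0}^n\bigr)=\mathrm{VR}_S(a)+\mathbb R\mathbf 1 .$$ 2. The map $C\mapsto\operatorname{val}^*(C\cap\boldsymbol{\mathcal H})$ is a poset isomorphism from $\mathrm{PD}(\mathbf S)$ onto $\mathrm{VD}(S)$. -/

import Mathlib

namespace TropVoronoi

noncomputable section

/-! ### Generalized dual Puiseux series -/

/-- The exponents of the series `x` that are at least `m`. Exponents live in `ℝᵒᵈ`, so that the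
well-ordered supports of Hahn series are the reverse well-ordered sets of reals. -/
def exponentsGE (x : HahnSeries ℝᵒᵈ ℝ) (m : ℝ) : Set ℝ :=
  {r : ℝ | m ≤ r ∧ x.coeff (OrderDual.toDual r) ≠ 0}

/-- The exponents can be listed as a (finite or infinite) strictly decreasing sequence of reals
without finite accumulation point: only finitely many of them are above any given real. -/
def IsDualPuiseux (x : HahnSeries ℝᵒᵈ ℝ) : Prop :=
  ∀ m : ℝ, (exponentsGE x m).Finite

theorem IsDualPuiseux.bound {x : HahnSeries ℝᵒᵈ ℝ} (hx : IsDualPuiseux x) :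
    ∃ B : ℝ, ∀ r : ℝ, x.coeff (OrderDual.toDual r) ≠ 0 → r ≤ B := by
  obtain ⟨B, hB⟩ := (hx 0).bddAbove
  refine ⟨max B 0, fun r hr => ?_⟩
  rcases le_total 0 r with h | h
  · exact le_max_of_le_left (hB ⟨h, hr⟩)
  · exact le_max_of_le_right h

theorem isDualPuiseux_single (g : ℝᵒᵈ) (c : ℝ) : IsDualPuiseux (HahnSeries.single g c) := by
  intro m
  refine (Set.finite_singleton (OrderDual.ofDual g)).subset ?_
  rintro r ⟨-, hr⟩
  by_contra h
  exact hr (HahnSeries.coeff_single_of_ne (fun e => h (by rw [← e]; rfl)))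

theorem isDualPuiseux_one : IsDualPuiseux 1 := isDualPuiseux_single 0 1

theorem IsDualPuiseux.add {x y : HahnSeries ℝᵒᵈ ℝ} (hx : IsDualPuiseux x)
    (hy : IsDualPuiseux y) : IsDualPuiseux (x + y) := by
  intro m
  refine ((hx m).union (hy m)).subset ?_
  rintro r ⟨hm, hr⟩
  by_contra h
  simp only [Set.mem_union, exponentsGE, Set.mem_ofPred_eq, not_or, not_and, not_not] at h
  exact hr (by rw [HahnSeries.coeff_add, h.1 hm, h.2 hm, add_zero])

theorem IsDualPuiseux.neg {x : HahnSeries ℝᵒᵈ ℝ} (hx : IsDualPuiseux x) :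
    IsDualPuiseux (-x) := by
  intro m
  refine (hx m).subset ?_
  rintro r ⟨hm, hr⟩
  exact ⟨hm, fun h => hr (by rw [HahnSeries.coeff_neg, h, neg_zero])⟩

theorem IsDualPuiseux.mul {x y : HahnSeries ℝᵒᵈ ℝ} (hx : IsDualPuiseux x)
    (hy : IsDualPuiseux y) : IsDualPuiseux (x * y) := by
  intro m
  obtain ⟨A, hA⟩ := hx.bound
  obtain ⟨B, hB⟩ := hy.bound
  refine ((hx (m - B)).image2 (fun a b => a + b) (hy (m - A))).subset ?_
  rintro r ⟨hm, hr⟩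
  obtain ⟨a, ha, b, hb, hab⟩ := HahnSeries.support_mul_subset (x := x) (y := y) hr
  have ha' : x.coeff (OrderDual.toDual (OrderDual.ofDual a)) ≠ 0 := ha
  have hb' : y.coeff (OrderDual.toDual (OrderDual.ofDual b)) ≠ 0 := hb
  have hab' : OrderDual.ofDual a + OrderDual.ofDual b = r := congrArg OrderDual.ofDual hab
  have h1 := hA _ ha'
  have h2 := hB _ hb'
  exact ⟨OrderDual.ofDual a, ⟨by linarith, ha'⟩, OrderDual.ofDual b, ⟨by linarith, hb'⟩, hab'⟩

theorem IsDualPuiseux.pow {x : HahnSeries ℝᵒᵈ ℝ} (hx : IsDualPuiseux x) (k : ℕ) :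
    IsDualPuiseux (x ^ k) := by
  induction k with
  | zero => rw [pow_zero]; exact isDualPuiseux_one
  | succ k ih => rw [pow_succ]; exact ih.mul hx

theorem coeff_pow_bound {x : HahnSeries ℝᵒᵈ ℝ} {B : ℝ}
    (hB : ∀ r : ℝ, x.coeff (OrderDual.toDual r) ≠ 0 → r ≤ B) (k : ℕ) :
    ∀ r : ℝ, (x ^ k).coeff (OrderDual.toDual r) ≠ 0 → r ≤ k * B := by
  induction k with
  | zero =>
    intro r hr
    have : OrderDual.toDual r = 0 := by
      by_contra h
      exact hr (by rw [pow_zero, HahnSeries.coeff_one, if_neg h])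
    have h0 : r = 0 := congrArg OrderDual.ofDual this
    simp [h0]
  | succ k ih =>
    intro r hr
    rw [pow_succ] at hr
    obtain ⟨a, ha, b, hb, hab⟩ := HahnSeries.support_mul_subset hr
    have hab' : OrderDual.ofDual a + OrderDual.ofDual b = r := congrArg OrderDual.ofDual hab
    have h1 := ih (OrderDual.ofDual a) ha
    have h2 := hB (OrderDual.ofDual b) hb
    push_cast
    linarith

theorem IsDualPuiseux.hsum_powers {x : HahnSeries ℝᵒᵈ ℝ} (hx : IsDualPuiseux x)
    (hpos : 0 < x.orderTop) : IsDualPuiseux (HahnSeries.SummableFamily.powers x).hsum := by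
  obtain ⟨B, hB0, hB⟩ : ∃ B : ℝ, B < 0 ∧
      ∀ r : ℝ, x.coeff (OrderDual.toDual r) ≠ 0 → r ≤ B := by
    by_cases h0 : x = 0
    · exact ⟨-1, by norm_num, fun r hr => absurd (by simp [h0]) hr⟩
    · refine ⟨OrderDual.ofDual x.order, ?_, fun r hr => ?_⟩
      · rw [← HahnSeries.order_eq_orderTop_of_ne_zero h0] at hpos
        have h1 : (0 : ℝᵒᵈ) < x.order := WithTop.coe_lt_coe.mp hpos
        exact h1
      · exact HahnSeries.order_le_of_coeff_ne_zero hr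
  intro m
  obtain ⟨N, hN⟩ := exists_nat_gt (m / B)
  refine ((Finset.range N).finite_toSet.biUnion (fun k _ => hx.pow k m)).subset ?_
  rintro r ⟨hm, hr⟩
  obtain ⟨k, hk⟩ := Set.mem_iUnion.mp (HahnSeries.SummableFamily.support_hsum_subset hr)
  rw [HahnSeries.SummableFamily.powers_of_orderTop_pos hpos] at hk
  refine Set.mem_biUnion (x := k) ?_ ⟨hm, hk⟩
  have h1 := coeff_pow_bound hB k r hk
  have h2 : (k : ℝ) ≤ m / B := by
    rw [le_div_iff_of_neg hB0]
    linarith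
  simpa using (by exact_mod_cast h2.trans_lt hN : k < N)

theorem IsDualPuiseux.inv {x : HahnSeries ℝᵒᵈ ℝ} (hx : IsDualPuiseux x) :
    IsDualPuiseux x⁻¹ := by
  by_cases h0 : x = 0
  · rw [h0, inv_zero, ← h0]; exact hx
  rw [HahnSeries.inv_def]
  refine (isDualPuiseux_single _ _).mul (IsDualPuiseux.hsum_powers ?_ ?_)
  · rw [sub_eq_add_neg]
    exact isDualPuiseux_one.add ((isDualPuiseux_single _ _).mul hx).neg
  · exact HahnSeries.unit_aux x
      (inv_mul_cancel₀ (HahnSeries.leadingCoeff_ne_zero.mpr h0)) _ (neg_add_cancel _)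

/-- The ordered field `𝕂` of generalized dual Puiseux series with real coefficients. The order is
the lexicographic one, which makes a series positive iff its leading coefficient, i.e. the
coefficient of its highest exponent, is positive. -/
def dualPuiseuxSubfield : Subfield (Lex (HahnSeries ℝᵒᵈ ℝ)) where
  carrier := {x | IsDualPuiseux (ofLex x)}
  mul_mem' := fun hx hy => IsDualPuiseux.mul hx hy
  one_mem' := isDualPuiseux_one
  add_mem' := fun hx hy => IsDualPuiseux.add hx hy
  zero_mem' := by
    intro m
    have : exponentsGE (ofLex (0 : Lex (HahnSeries ℝᵒᵈ ℝ))) m = ∅ := by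
      ext r; simp [exponentsGE]
    rw [this]; exact Set.finite_empty
  neg_mem' := fun hx => IsDualPuiseux.neg hx
  inv_mem' := fun _ hx => IsDualPuiseux.inv hx

/-- The field `𝕂` as a type. -/
abbrev DualPuiseux : Type := dualPuiseuxSubfield

/-- The dual valuation `val*`: the highest exponent (with the irrelevant value `0` at `0`). -/
def dualVal (x : DualPuiseux) : ℝ :=
  OrderDual.ofDual (ofLex (x : Lex (HahnSeries ℝᵒᵈ ℝ))).order

/-- The coordinatewise dual valuation. It is only used at points with positive coordinates. -/
def dualValMap {n : ℕ} (X : Fin n → DualPuiseux) : Fin n → ℝ :=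
  fun i => dualVal (X i)

/-! ### Asymmetric tropical Voronoi diagrams -/

/-- The tropical hypersurface `x₁ + ⋯ + xₙ = 0`. -/
def tropHyp (n : ℕ) : Set (Fin n → ℝ) :=
  {x | ∑ i, x i = 0}

/-- The asymmetric tropical distance from `a` to `b`. -/
def asymDist {n : ℕ} (a b : Fin n → ℝ) : ℝ :=
  ∑ i, (b i - a i) + n * ⨆ i, (a i - b i)

/-- The Voronoi region of the site `a` with respect to the set of sites `S`. -/
def voronoiRegion {n : ℕ} (S : Set (Fin n → ℝ)) (a : Fin n → ℝ) : Set (Fin n → ℝ) :=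
  {x | x ∈ tropHyp n ∧ ∀ b ∈ S, asymDist x a ≤ asymDist x b}

/-- The Voronoi diagram: all intersections of nonempty families of Voronoi regions. As a set of
sets it is partially ordered by inclusion. -/
def voronoiDiagram {n : ℕ} (S : Set (Fin n → ℝ)) : Set (Set (Fin n → ℝ)) :=
  {C | ∃ T ⊆ S, T.Nonempty ∧ C = ⋂ a ∈ T, voronoiRegion S a}

/-- Any two distinct sites differ in every coordinate. -/
def InGeneralPosition {n : ℕ} (S : Set (Fin n → ℝ)) : Prop :=
  ∀ a ∈ S, ∀ b ∈ S, a ≠ b → ∀ i, a i ≠ b i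

/-- Every coordinate projection of `S` is a discrete subset of `ℝ`. -/
def SuperDiscrete {n : ℕ} (S : Set (Fin n → ℝ)) : Prop :=
  ∀ i, IsDiscrete ((fun x : Fin n → ℝ => x i) '' S)

/-! ### Farthest power diagrams -/

/-- The square of the Euclidean norm on `𝕂ⁿ`. -/
def normSq {n : ℕ} (X : Fin n → DualPuiseux) : DualPuiseux :=
  ∑ i, X i ^ 2

/-- The farthest power region of `a` with respect to the sites `S` and the weight function `w`;
it is a subset of the nonnegative orthant. -/
def powerRegion {n : ℕ} (S : Set (Fin n → DualPuiseux))
    (w : (Fin n → DualPuiseux) → DualPuiseux) (a : Fin n → DualPuiseux) :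
    Set (Fin n → DualPuiseux) :=
  {X | (∀ i, 0 ≤ X i) ∧ ∀ b ∈ S, normSq (X - b) - w b ≤ normSq (X - a) - w a}

/-- The farthest power diagram: all intersections of nonempty families of farthest power regions.
As a set of sets it is partially ordered by inclusion. -/
def powerDiagram {n : ℕ} (S : Set (Fin n → DualPuiseux))
    (w : (Fin n → DualPuiseux) → DualPuiseux) : Set (Set (Fin n → DualPuiseux)) :=
  {C | ∃ T ⊆ S, T.Nonempty ∧ C = ⋂ a ∈ T, powerRegion S w a}

/-- The open positive orthant of `𝕂ⁿ`. -/
def posOrthant (n : ℕ) : Set (Fin n → DualPuiseux) :=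
  {X | ∀ i, 0 < X i}

/-- The hypersurface `X₁ ⋯ Xₙ = 1` in the open positive orthant of `𝕂ⁿ`. -/
def puiseuxHyp (n : ℕ) : Set (Fin n → DualPuiseux) :=
  {X | X ∈ posOrthant n ∧ ∏ i, X i = 1}

end

end TropVoronoi

open TropVoronoi

/-!
Expanding the squares turns the farthest power region of `A` into the set of nonnegative `X` with
`⟨X, A⟩ ≤ ⟨X, B⟩` for all sites `B`, and on `tropHyp n` the Voronoi region of `-val* A` into the
set of `x` with `max (x + val* A) ≤ max (x + val* B)` for all `B`. Since `val*` turns sums of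
positive series into maxima, valuations of points of power regions lie in Voronoi regions
(`LiftedSites.dualValMap_mem`).

For the converse (`LiftedSites.exists_lift`), let `x` lie in the Voronoi regions of a family `T`.
By general position a coordinate determines at most one site, so only finitely many sites `B`
attain the minimal value `m` of `max (x + val* B)`, and their sets of maximizing coordinates are
disjoint. After rescaling, prescribing `⟨X, B⟩ = t ^ m` for the sites of `T` and
`⟨X, B⟩ = 2 t ^ m` for the other ones of these sites is a linear system whose matrix differs from
the identity by infinitesimals; it has a solution with entries between two positive rational
numbers (`exists_block_solution`), and hence with the prescribed valuation. All remaining sites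
pair with `X` to something of larger valuation. The product of the coordinates is made equal to `1`
by means of an `n`-th root in `𝕂`, provided by the binomial series
(`exists_pow_eq_of_dualVal_eq_zero`).

Hence tropicalization maps the cell of `T` in the power diagram onto the cell of `T` in the Voronoi
diagram. It reflects inclusions because a nonempty tropical cell determines the sites it
belongs to (`LiftedSites.mem_of_iInter_subset`), while a power cell with empty tropicalization
consists of the origin alone (`LiftedSites.exists_mem_tropCell`), which lies in every power region.
-/

namespace TropVoronoi

noncomputable section

/-! ### The field of generalized dual Puiseux series -/

theorem ofLex_ne_zero {x : DualPuiseux} (hx : x ≠ 0) :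
    ofLex (x : Lex (HahnSeries ℝᵒᵈ ℝ)) ≠ 0 :=
  fun h => hx (Subtype.ext h)

theorem dualVal_mul {x y : DualPuiseux} (hx : x ≠ 0) (hy : y ≠ 0) :
    dualVal (x * y) = dualVal x + dualVal y :=
  congrArg OrderDual.ofDual (HahnSeries.order_mul (ofLex_ne_zero hx) (ofLex_ne_zero hy))

theorem dualVal_one : dualVal 1 = 0 :=
  congrArg OrderDual.ofDual (HahnSeries.order_one (Γ := ℝᵒᵈ) (R := ℝ))

theorem dualVal_inv {x : DualPuiseux} (hx : x ≠ 0) : dualVal x⁻¹ = -dualVal x := by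
  have h := dualVal_mul hx (inv_ne_zero hx)
  rw [mul_inv_cancel₀ hx, dualVal_one] at h
  linarith

theorem dualVal_pow {x : DualPuiseux} (hx : x ≠ 0) (k : ℕ) :
    dualVal (x ^ k) = k * dualVal x := by
  induction k with
  | zero => simp [dualVal_one]
  | succ k ih => rw [pow_succ, dualVal_mul (pow_ne_zero k hx) hx, ih]; push_cast; ring

theorem dualVal_prod {ι : Type*} (s : Finset ι) {x : ι → DualPuiseux} (hx : ∀ i ∈ s, x i ≠ 0) :
    dualVal (∏ i ∈ s, x i) = ∑ i ∈ s, dualVal (x i) := by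
  classical
  induction s using Finset.induction_on with
  | empty => simp [dualVal_one]
  | insert i s his ih =>
    rw [Finset.prod_insert his, Finset.sum_insert his, dualVal_mul (hx i (by simp))
      (Finset.prod_ne_zero_iff.mpr fun j hj => hx j (by simp [hj])),
      ih fun j hj => hx j (by simp [hj])]

/-- The constant series of a real number. -/
def const (c : ℝ) : DualPuiseux :=
  ⟨toLex (HahnSeries.single 0 c), isDualPuiseux_single 0 c⟩

theorem const_mul (c d : ℝ) : const (c * d) = const c * const d := by
  refine Subtype.ext ?_
  have h := HahnSeries.single_mul_single (a := (0 : ℝᵒᵈ)) (b := 0) (r := c) (s := d)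
  rw [add_zero] at h
  exact h.symm

theorem const_one : const 1 = 1 := Subtype.ext rfl

theorem const_pow (c : ℝ) (k : ℕ) : const (c ^ k) = const c ^ k := by
  induction k with
  | zero => simp [const_one]
  | succ k ih => rw [pow_succ, pow_succ, const_mul, ih]

theorem dualVal_natCast (k : ℕ) : dualVal (k : DualPuiseux) = 0 := by
  have h : ofLex ((k : DualPuiseux) : Lex (HahnSeries ℝᵒᵈ ℝ))
      = HahnSeries.C (k : ℝ) := by
    rw [map_natCast]; rfl
  rw [dualVal, h, HahnSeries.order_C]; rfl

/-- The monomial `t ^ r`. -/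
def mono (r : ℝ) : DualPuiseux :=
  ⟨toLex (HahnSeries.single (OrderDual.toDual r) 1), isDualPuiseux_single _ 1⟩

theorem mono_pos (r : ℝ) : 0 < mono r := by
  have : 0 < (HahnSeries.single (OrderDual.toDual r) (1 : ℝ)).leadingCoeff := by
    rw [HahnSeries.leadingCoeff_of_single]; exact one_pos
  exact HahnSeries.leadingCoeff_pos_iff.mp this

theorem dualVal_mono (r : ℝ) : dualVal (mono r) = r :=
  congrArg OrderDual.ofDual (HahnSeries.order_single (Γ := ℝᵒᵈ) (R := ℝ) one_ne_zero)

theorem mono_add (r s : ℝ) : mono (r + s) = mono r * mono s := by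
  have h := HahnSeries.single_mul_single (a := OrderDual.toDual r) (b := OrderDual.toDual s)
    (r := (1 : ℝ)) (s := 1)
  rw [mul_one] at h
  exact Subtype.ext h.symm

theorem mono_zero : mono 0 = 1 := Subtype.ext rfl

theorem mono_sum {ι : Type*} (s : Finset ι) (f : ι → ℝ) :
    mono (∑ i ∈ s, f i) = ∏ i ∈ s, mono (f i) := by
  classical
  induction s using Finset.induction_on with
  | empty => simp [mono_zero]
  | insert i s his ih => rw [Finset.sum_insert his, Finset.prod_insert his, mono_add, ih]

theorem lt_of_dualVal_lt {x y : DualPuiseux} (hy : 0 < y)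
    (h : dualVal x < dualVal y) : x < y := by
  refine (HahnSeries.lt_iff (x : Lex (HahnSeries ℝᵒᵈ ℝ)) y).mpr
    ⟨(ofLex (y : Lex (HahnSeries ℝᵒᵈ ℝ))).order, fun j hj => ?_, ?_⟩
  · rw [HahnSeries.coeff_eq_zero_of_lt_order hj,
      HahnSeries.coeff_eq_zero_of_lt_order (hj.trans h)]
  · rw [HahnSeries.coeff_eq_zero_of_lt_order h, ← HahnSeries.leadingCoeff_eq]
    exact HahnSeries.leadingCoeff_pos_iff.mpr hy

theorem dualVal_le_of_le {x y : DualPuiseux} (hx : 0 < x) (h : x ≤ y) :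
    dualVal x ≤ dualVal y :=
  le_of_not_gt fun hlt => (lt_of_dualVal_lt hx hlt).not_ge h

theorem dualVal_eq_zero_of_mem_Icc {x : DualPuiseux} {k l : ℕ}
    (hk : ((k : DualPuiseux) + 1)⁻¹ ≤ x) (hl : x ≤ l) : dualVal x = 0 := by
  have hk0 : (0 : DualPuiseux) < ((k : DualPuiseux) + 1)⁻¹ := by positivity
  refine le_antisymm ?_ ?_
  · simpa [dualVal_natCast] using dualVal_le_of_le (hk0.trans_le hk) hl
  · have h := dualVal_le_of_le hk0 hk
    rw [dualVal_inv (by positivity)] at h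
    have := dualVal_natCast (k + 1)
    push_cast at this
    rwa [this, neg_zero] at h

/-- The valuation turns sums of nonnegative series into maxima: if all terms had smaller valuation
than `q`, each of them would be less than `q / (card ι + 1)`. -/
theorem exists_dualVal_le_of_le_sum {ι : Type*} [Fintype ι] {q : DualPuiseux}
    {y : ι → DualPuiseux} (hq : 0 < q) (hy : ∀ i, 0 ≤ y i) (h : q ≤ ∑ i, y i) :
    ∃ i, 0 < y i ∧ dualVal q ≤ dualVal (y i) := by
  by_contra! hcon
  set k : DualPuiseux := ((Fintype.card ι + 1 : ℕ) : DualPuiseux) with hk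
  have hk0 : 0 < k := by rw [hk]; positivity
  have hkv : dualVal (q * k⁻¹) = dualVal q := by
    rw [dualVal_mul hq.ne' (inv_ne_zero hk0.ne'), dualVal_inv hk0.ne', hk, dualVal_natCast]
    ring
  have hqk : 0 < q * k⁻¹ := mul_pos hq (inv_pos.mpr hk0)
  have hle : ∀ i, y i ≤ q * k⁻¹ := by
    intro i
    rcases (hy i).eq_or_lt with h0 | h0
    · rw [← h0]; exact hqk.le
    · exact (lt_of_dualVal_lt hqk (by rw [hkv]; exact hcon i h0)).le
  have h1 : ∑ i, y i ≤ Fintype.card ι * (q * k⁻¹) := by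
    refine (Finset.sum_le_card_nsmul _ _ _ fun i _ => hle i).trans_eq ?_
    rw [nsmul_eq_mul, Finset.card_univ]
  have h2 : k * (q * k⁻¹) = q := by field_simp
  have h3 : k * (q * k⁻¹) = Fintype.card ι * (q * k⁻¹) + q * k⁻¹ := by
    rw [hk]; push_cast; ring
  exact absurd (h.trans h1) (not_le.mpr (by rw [← h2, h3] ; linarith))

/-- Substituting a series of negative valuation into a power series does not create an
accumulation of exponents: the `k`-th power only contributes exponents below `k * B`, where
`B < 0` bounds the exponents of `x`. -/
theorem IsDualPuiseux.heval {x : HahnSeries ℝᵒᵈ ℝ} (hx : IsDualPuiseux x)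
    (hpos : 0 < x.orderTop) (f : PowerSeries ℝ) : IsDualPuiseux (PowerSeries.heval x f) := by
  obtain ⟨B, hB0, hB⟩ : ∃ B : ℝ, B < 0 ∧
      ∀ r : ℝ, x.coeff (OrderDual.toDual r) ≠ 0 → r ≤ B := by
    by_cases h0 : x = 0
    · exact ⟨-1, by norm_num, fun r hr => absurd (by simp [h0]) hr⟩
    · refine ⟨OrderDual.ofDual x.order, ?_, fun r hr => HahnSeries.order_le_of_coeff_ne_zero hr⟩
      rw [← HahnSeries.order_eq_orderTop_of_ne_zero h0] at hpos
      have h1 : (0 : ℝᵒᵈ) < x.order := WithTop.coe_lt_coe.mp hpos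
      exact h1
  intro m
  obtain ⟨N, hN⟩ := exists_nat_gt (m / B)
  refine ((Finset.range N).finite_toSet.biUnion (fun k _ => hx.pow k m)).subset ?_
  rintro r ⟨hm, hr⟩
  rw [PowerSeries.heval_apply] at hr
  obtain ⟨k, hk⟩ := Set.mem_iUnion.mp (HahnSeries.SummableFamily.support_hsum_subset hr)
  rw [HahnSeries.SummableFamily.powerSeriesFamily_of_orderTop_pos hpos] at hk
  have hk' : (x ^ k).coeff (OrderDual.toDual r) ≠ 0 := fun h0 =>
    hk (by rw [HahnSeries.coeff_smul, h0, smul_zero])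
  refine Set.mem_biUnion (x := k) ?_ ⟨hm, hk'⟩
  have h1 := coeff_pow_bound hB k r hk'
  have h2 : (k : ℝ) ≤ m / B := by
    rw [le_div_iff_of_neg hB0]
    linarith
  simpa using (by exact_mod_cast h2.trans_lt hN : k < N)

/-- Positive series of valuation zero have roots: the binomial series provides a root of
`1 + ε` for every infinitesimal `ε`. -/
theorem exists_pow_eq_of_dualVal_eq_zero {x : DualPuiseux} (hx : 0 < x) (hv : dualVal x = 0)
    {k : ℕ} (hk : k ≠ 0) : ∃ y : DualPuiseux, 0 < y ∧ dualVal y = 0 ∧ y ^ k = x := by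
  set X : HahnSeries ℝᵒᵈ ℝ := ofLex (x : Lex (HahnSeries ℝᵒᵈ ℝ)) with hX
  have hXP : IsDualPuiseux X := x.2
  have hc : 0 < X.leadingCoeff := HahnSeries.leadingCoeff_pos_iff.mpr hx
  have ho : X.order = 0 := hv
  set c := X.leadingCoeff
  set e : HahnSeries ℝᵒᵈ ℝ := -(1 - HahnSeries.single 0 c⁻¹ * X) with he
  have hepos : 0 < e.orderTop := by
    rw [he, HahnSeries.orderTop_neg]
    exact HahnSeries.unit_aux X (inv_mul_cancel₀ hc.ne') _ (by rw [ho, add_zero])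
  have heP : IsDualPuiseux e := by
    rw [he, sub_eq_add_neg]
    exact (isDualPuiseux_one.add ((isDualPuiseux_single _ _).mul hXP).neg).neg
  set Z : HahnSeries ℝᵒᵈ ℝ :=
    PowerSeries.heval e (PowerSeries.binomialSeries ℝ ((k : ℝ)⁻¹)) with hZ
  have hroot : ∀ j : ℕ, (PowerSeries.binomialSeries ℝ ((k : ℝ)⁻¹)) ^ j
      = PowerSeries.binomialSeries ℝ ((j : ℝ) * (k : ℝ)⁻¹) := by
    intro j
    induction j with
    | zero => simp
    | succ j ih => rw [pow_succ, ih, ← PowerSeries.binomialSeries_add]; congr 1; push_cast; ring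
  have hZk : Z ^ k = HahnSeries.single 0 c⁻¹ * X := by
    have h1 := PowerSeries.binomialSeries_nat (R := ℝ) (A := ℝ) 1
    rw [hZ, ← map_pow, hroot, mul_inv_cancel₀ (Nat.cast_ne_zero.mpr hk), ← Nat.cast_one, h1,
      pow_one, map_add, map_one, PowerSeries.heval_X _ hepos, he]
    ring
  set z : DualPuiseux := ⟨toLex Z, heP.heval hepos _⟩
  have hzk : z ^ k = const c⁻¹ * x := Subtype.ext hZk
  set y : DualPuiseux := const (c ^ (k : ℝ)⁻¹) * z
  have hyk : y ^ k = x := by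
    rw [mul_pow, hzk, ← const_pow, ← mul_assoc, ← const_mul, ← Real.rpow_natCast,
      ← Real.rpow_mul hc.le, inv_mul_cancel₀ (Nat.cast_ne_zero.mpr hk), Real.rpow_one,
      mul_inv_cancel₀ hc.ne', const_one, one_mul]
  have hy0 : y ≠ 0 := by
    rintro h0
    rw [h0, zero_pow hk] at hyk
    exact hx.ne hyk
  -- For even `k` the root `y` may be negative.
  have hak : |y| ^ k = x := by rw [← abs_pow, hyk, abs_of_pos hx]
  refine ⟨|y|, abs_pos.mpr hy0, ?_, hak⟩
  have h := dualVal_pow (abs_pos.mpr hy0).ne' k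
  rw [hak, hv] at h
  exact (mul_eq_zero.mp h.symm).resolve_left (Nat.cast_ne_zero.mpr hk)

/-! ### Regions as sets of minimizers -/

/-- The inequality `max (x + p) ≤ max (x + q)` between two tropical linear forms evaluated at `x`,
spelled out without suprema. -/
def TropLE {n : ℕ} (x p q : Fin n → ℝ) : Prop :=
  ∀ i, ∃ j, x i + p i ≤ x j + q j

theorem tropLE_add_const {n : ℕ} {x p q : Fin n → ℝ} (h : TropLE x p q) (c : ℝ) :
    TropLE (fun i => x i + c) p q := by
  intro i
  obtain ⟨j, hj⟩ := h i
  exact ⟨j, by linarith⟩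

theorem asymDist_le_iff {n : ℕ} {x a b : Fin n → ℝ} (ha : a ∈ tropHyp n) (hb : b ∈ tropHyp n) :
    asymDist x a ≤ asymDist x b ↔ TropLE x (-a) (-b) := by
  rcases Nat.eq_zero_or_pos n with rfl | hn
  · simp [asymDist, TropLE]
  have : Nonempty (Fin n) := ⟨⟨0, hn⟩⟩
  have ha' : ∑ i, a i = 0 := ha
  have hb' : ∑ i, b i = 0 := hb
  have hn' : (0 : ℝ) < n := Nat.cast_pos.mpr hn
  unfold asymDist TropLE
  rw [Finset.sum_sub_distrib, Finset.sum_sub_distrib, ha', hb', add_le_add_iff_left,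
    mul_le_mul_iff_right₀ hn']
  simp only [Pi.neg_apply, ← sub_eq_add_neg]
  constructor
  · intro h i
    obtain ⟨j, hj⟩ := exists_eq_ciSup_of_finite (f := fun i => x i - b i)
    exact ⟨j, ((le_ciSup (Set.finite_range (fun i => x i - a i)).bddAbove i).trans h).trans_eq
      hj.symm⟩
  · intro h
    refine ciSup_le fun i => ?_
    obtain ⟨j, hj⟩ := h i
    exact hj.trans (le_ciSup (Set.finite_range (fun i => x i - b i)).bddAbove j)

/-- The Euclidean pairing on `𝕂ⁿ`. -/
def pairing {n : ℕ} (X A : Fin n → DualPuiseux) : DualPuiseux :=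
  ∑ i, X i * A i

/-- With the weight function `‖·‖²`, power regions are the sets of minimizers of linear forms. -/
theorem mem_powerRegion_iff {n : ℕ} {L : Set (Fin n → DualPuiseux)} {A X : Fin n → DualPuiseux} :
    X ∈ powerRegion L normSq A ↔
      (∀ i, 0 ≤ X i) ∧ ∀ B ∈ L, pairing X A ≤ pairing X B := by
  have key : ∀ B : Fin n → DualPuiseux,
      normSq (X - B) - normSq B = normSq X - 2 * pairing X B := by
    intro B
    simp only [normSq, pairing, Finset.mul_sum, ← Finset.sum_sub_distrib]
    refine Finset.sum_congr rfl fun i _ => ?_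
    rw [Pi.sub_apply]; ring
  change ((∀ i, 0 ≤ X i) ∧ _) ↔ _
  simp only [key]
  refine and_congr_right fun _ => forall₂_congr fun B _ => ?_
  constructor <;> intro h <;> linarith

theorem zero_mem_powerRegion {n : ℕ} (L : Set (Fin n → DualPuiseux)) (A : Fin n → DualPuiseux) :
    0 ∈ powerRegion L normSq A := by
  rw [mem_powerRegion_iff]
  simp [pairing]

/-- Positive sites in `𝕂ⁿ` whose valuations are in general position: two sites whose valuations
agree in one coordinate are equal. -/
structure LiftedSites {n : ℕ} (L : Set (Fin n → DualPuiseux)) : Prop where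
  pos : ∀ A ∈ L, ∀ i, 0 < A i
  sep : ∀ A ∈ L, ∀ B ∈ L, ∀ i, dualVal (A i) = dualVal (B i) → A = B

/-- The points `x`, not necessarily on `tropHyp n`, at which the tropical linear form given by `A`
is minimal among those given by `L`. -/
def tropCell {n : ℕ} (L : Set (Fin n → DualPuiseux)) (A : Fin n → DualPuiseux) :
    Set (Fin n → ℝ) :=
  {x | ∀ B ∈ L, TropLE x (dualValMap A) (dualValMap B)}

theorem tropCell_add_const {n : ℕ} {L : Set (Fin n → DualPuiseux)} {A : Fin n → DualPuiseux}
    {x : Fin n → ℝ} (hx : x ∈ tropCell L A) (c : ℝ) : (fun i => x i + c) ∈ tropCell L A :=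
  fun B hB => tropLE_add_const (hx B hB) c

/-- Each coordinate determines at most one site. -/
theorem LiftedSites.finite {n : ℕ} {L : Set (Fin n → DualPuiseux)} (hL : LiftedSites L)
    (f : Fin n → ℝ) : {A ∈ L | ∃ i, dualVal (A i) = f i}.Finite := by
  have : {A ∈ L | ∃ i, dualVal (A i) = f i} = ⋃ i, {A ∈ L | dualVal (A i) = f i} := by
    ext A; simp
  rw [this]
  refine Set.finite_iUnion fun i => Set.Subsingleton.finite ?_
  rintro A ⟨hA, h1⟩ B ⟨hB, h2⟩
  exact hL.sep A hA B hB i (h1.trans h2.symm)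

/-- The valuation of a positive point of a power region is tropically minimal. -/
theorem LiftedSites.dualValMap_mem {n : ℕ} {L : Set (Fin n → DualPuiseux)} (hL : LiftedSites L)
    {A X : Fin n → DualPuiseux} (hA : A ∈ L) (hX : X ∈ powerRegion L normSq A)
    (hpos : X ∈ posOrthant n) : dualValMap X ∈ tropCell L A := by
  intro B hB i
  have h := (mem_powerRegion_iff.mp hX).2 B hB
  have hq : 0 < X i * A i := mul_pos (hpos i) (hL.pos A hA i)
  have h1 : X i * A i ≤ pairing X A :=
    Finset.single_le_sum (f := fun i => X i * A i)
      (fun j _ => (mul_pos (hpos j) (hL.pos A hA j)).le) (Finset.mem_univ i)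
  obtain ⟨j, -, hj⟩ := exists_dualVal_le_of_le_sum hq
    (fun j => (mul_pos (hpos j) (hL.pos B hB j)).le) (h1.trans h)
  rw [dualVal_mul (hpos i).ne' (hL.pos A hA i).ne',
    dualVal_mul (hpos j).ne' (hL.pos B hB j).ne'] at hj
  exact ⟨j, hj⟩

/-- A nonzero common point of power regions, possibly on the boundary of the orthant, shows that
the corresponding tropical cells meet: vanishing coordinates are replaced by very small
exponents. -/
theorem LiftedSites.exists_mem_tropCell {n : ℕ} {L : Set (Fin n → DualPuiseux)}
    (hL : LiftedSites L) {T : Set (Fin n → DualPuiseux)} (hT : T ⊆ L) (hne : T.Nonempty)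
    {X : Fin n → DualPuiseux} (hX : ∀ A ∈ T, X ∈ powerRegion L normSq A) (hX0 : X ≠ 0) :
    ∃ x, ∀ A ∈ T, x ∈ tropCell L A := by
  obtain ⟨A₀, hA₀⟩ := hne
  have hXnn : ∀ i, 0 ≤ X i := (mem_powerRegion_iff.mp (hX A₀ hA₀)).1
  obtain ⟨i₀, hi₀⟩ : ∃ i, X i ≠ 0 := Function.ne_iff.mp hX0
  have hterm : ∀ B ∈ L, ∀ i, 0 ≤ X i * B i := fun B hB i =>
    mul_nonneg (hXnn i) (hL.pos B hB i).le
  have hsingle : ∀ B ∈ L, ∀ i, X i * B i ≤ pairing X B := fun B hB i =>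
    Finset.single_le_sum (f := fun i => X i * B i) (fun j _ => hterm B hB j) (Finset.mem_univ i)
  set q := pairing X A₀ with hq
  have hq0 : 0 < q := (mul_pos ((hXnn i₀).lt_of_ne' hi₀) (hL.pos A₀ (hT hA₀) i₀)).trans_le
    (hsingle A₀ (hT hA₀) i₀)
  have hTq : ∀ A ∈ T, pairing X A ≤ q := fun A hA =>
    (mem_powerRegion_iff.mp (hX A hA)).2 A₀ (hT hA₀)
  have hlow : ∀ B ∈ L, ∃ j, X j ≠ 0 ∧ dualVal q ≤ dualVal (X j) + dualVal (B j) := by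
    intro B hB
    obtain ⟨j, hj0, hj⟩ := exists_dualVal_le_of_le_sum hq0 (hterm B hB)
      ((mem_powerRegion_iff.mp (hX A₀ hA₀)).2 B hB)
    have hXj : X j ≠ 0 := left_ne_zero_of_mul hj0.ne'
    exact ⟨j, hXj, hj.trans_eq (dualVal_mul hXj (hL.pos B hB j).ne')⟩
  have hup : ∀ A ∈ T, ∀ i, X i ≠ 0 → dualVal (X i) + dualVal (A i) ≤ dualVal q := by
    intro A hA i hi
    rw [← dualVal_mul hi (hL.pos A (hT hA) i).ne']
    exact dualVal_le_of_le (mul_pos ((hXnn i).lt_of_ne' hi) (hL.pos A (hT hA) i))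
      ((hsingle A (hT hA) i).trans (hTq A hA))
  have hfin : T.Finite := by
    refine (hL.finite fun i => dualVal q - dualVal (X i)).subset fun A hA => ⟨hT hA, ?_⟩
    obtain ⟨j, hj0, hj⟩ := hlow A (hT hA)
    exact ⟨j, by have := hup A hA j hj0; linarith⟩
  have hbdd : ∀ i, ∃ M, ∀ A ∈ T, M ≤ dualVal q - dualVal (A i) := by
    intro i
    obtain ⟨M, hM⟩ := (hfin.image fun A => dualVal q - dualVal (A i)).bddBelow
    exact ⟨M, fun A hA => hM ⟨A, hA, rfl⟩⟩
  choose M hM using hbdd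
  classical
  refine ⟨fun i => if X i = 0 then M i else dualVal (X i), fun A hA B hB i => ?_⟩
  obtain ⟨j, hj0, hj⟩ := hlow B hB
  refine ⟨j, ?_⟩
  simp only [dualValMap, if_neg hj0]
  refine le_trans ?_ hj
  split_ifs with hi
  · have := hM i A hA; linarith
  · exact hup A hA i hi

/-- If the cell of a family `T` of sites is nonempty and contained in the tropical cell of a site
`A'`, then `A'` belongs to `T`: otherwise, raising a coordinate where `A'` attains its maximum
leaves the maxima of the members of `T` unchanged, but not that of `A'`. -/
theorem LiftedSites.mem_of_iInter_subset {n : ℕ} {L : Set (Fin n → DualPuiseux)}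
    (hL : LiftedSites L) {T : Set (Fin n → DualPuiseux)} (hT : T ⊆ L) (hne : T.Nonempty)
    {A' : Fin n → DualPuiseux} (hA' : A' ∈ L) {x : Fin n → ℝ} (hx : ∀ A ∈ T, x ∈ tropCell L A)
    (hsub : ∀ y, (∀ A ∈ T, y ∈ tropCell L A) → y ∈ tropCell L A') : A' ∈ T := by
  by_contra hA'T
  obtain ⟨A₀, hA₀⟩ := hne
  rcases Nat.eq_zero_or_pos n with rfl | hn
  · exact hA'T (Subsingleton.elim A₀ A' ▸ hA₀)
  have : Nonempty (Fin n) := ⟨⟨0, hn⟩⟩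
  obtain ⟨i₀, hi₀⟩ := Finite.exists_max fun i => x i + dualVal (A₀ i)
  set m := x i₀ + dualVal (A₀ i₀) with hm
  have hup : ∀ A ∈ T, ∀ i, x i + dualVal (A i) ≤ m := by
    intro A hA i
    obtain ⟨j, hj⟩ := hx A hA A₀ (hT hA₀) i
    exact hj.trans (hi₀ j)
  have hlow : ∀ B ∈ L, ∃ j, m ≤ x j + dualVal (B j) := fun B hB => hx A₀ hA₀ B hB i₀
  have hup' : ∀ i, x i + dualVal (A' i) ≤ m := by
    intro i
    obtain ⟨j, hj⟩ := hsub x hx A₀ (hT hA₀) i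
    exact hj.trans (hi₀ j)
  obtain ⟨j, hj⟩ := hlow A' hA'
  -- By general position the members of `T` stay below `m` at `j`, so there is room to raise `x j`.
  have hgap : ∀ A ∈ T, 0 < m - (x j + dualVal (A j)) := by
    intro A hA
    refine sub_pos.mpr ((hup A hA j).lt_of_ne fun h => hA'T ?_)
    rwa [← hL.sep A (hT hA) A' hA' j (by have := hup' j; linarith)]
  have hfin : T.Finite := by
    refine (hL.finite fun i => m - x i).subset fun A hA => ⟨hT hA, ?_⟩
    obtain ⟨k, hk⟩ := hlow A (hT hA)
    exact ⟨k, by have := hup A hA k; linarith⟩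
  obtain ⟨A₁, hA₁, hmin⟩ :=
    Set.exists_min_image T (fun A => m - (x j + dualVal (A j))) hfin ⟨A₀, hA₀⟩
  have hε := hgap A₁ hA₁
  set ε := m - (x j + dualVal (A₁ j))
  have hle : ∀ i, x i ≤ Function.update x j (x j + ε) i := by
    intro i
    rcases eq_or_ne i j with rfl | hij
    · rw [Function.update_self]; linarith
    · rw [Function.update_of_ne hij]
  have hyup : ∀ A ∈ T, ∀ i, Function.update x j (x j + ε) i + dualVal (A i) ≤ m := by
    intro A hA i
    rcases eq_or_ne i j with rfl | hij
    · rw [Function.update_self]; linarith [hmin A hA]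
    · rw [Function.update_of_ne hij]; exact hup A hA i
  have hy : ∀ A ∈ T, Function.update x j (x j + ε) ∈ tropCell L A := by
    intro A hA B hB i
    obtain ⟨k, hk⟩ := hlow B hB
    exact ⟨k, (hyup A hA i).trans (hk.trans (add_le_add (hle k) le_rfl))⟩
  obtain ⟨k, hk⟩ := hsub _ hy A₀ (hT hA₀) j
  have h1 := hyup A₀ hA₀ k
  rw [Function.update_self] at hk
  simp only [dualValMap] at hk
  linarith

/-! ### Lifting points of tropical cells -/

/-- If `∑ i, G i = 1` over the indices where `u` takes the value `c` and the remaining coefficients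
are small, then `∑ i, G i * u i` is close to `c`. -/
theorem abs_sum_mul_sub_le {K ι : Type*} [Field K] [LinearOrder K] [IsStrictOrderedRing K]
    [Fintype ι] {G u : ι → K} {c Y : K} (p : ι → Prop) [DecidablePred p] (hG : ∀ i, 0 ≤ G i)
    (h1 : ∑ i with p i, G i = 1) (h2 : ∑ i with ¬ p i, G i ≤ 1 / 8)
    (hu : ∀ i, p i → u i = c) (hY : ∀ i, |u i| ≤ Y) (hY0 : 0 ≤ Y) :
    |∑ i, G i * u i - c| ≤ Y / 8 := by
  have h3 : ∑ i with p i, G i * u i = c := by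
    rw [Finset.sum_congr rfl fun i hi => by rw [hu i (Finset.mem_filter.mp hi).2],
      ← Finset.sum_mul, h1, one_mul]
  rw [← Finset.sum_filter_add_sum_filter_not Finset.univ p, h3, add_sub_cancel_left]
  calc |∑ i with ¬ p i, G i * u i| ≤ ∑ i with ¬ p i, |G i * u i| := Finset.abs_sum_le_sum_abs _ _
    _ ≤ ∑ i with ¬ p i, G i * Y := Finset.sum_le_sum fun i _ => by
        rw [abs_mul, abs_of_nonneg (hG i)]
        exact mul_le_mul_of_nonneg_left (hY i) (hG i)
    _ = (∑ i with ¬ p i, G i) * Y := by rw [Finset.sum_mul]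
    _ ≤ 1 / 8 * Y := mul_le_mul_of_nonneg_right h2 hY0
    _ = Y / 8 := by ring

/-- A linear system whose matrix is close to the identity, over an arbitrary ordered field. The
coordinates are partitioned into blocks indexed by the equations, together with one block of
coordinates (those with `o i = none`) fixed to `1`; the unknown `y B` is the common value on the
block of `B`. -/
theorem exists_block_solution {K ι F : Type*} [Field K] [LinearOrder K] [IsStrictOrderedRing K]
    [Fintype ι] [Finite F] [DecidableEq F] (o : ι → Option F) (G : F → ι → K)
    (hG : ∀ B i, 0 ≤ G B i)
    (h1 : ∀ B, ∑ i with o i = some B, G B i = 1)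
    (h2 : ∀ B, ∑ i with ¬ o i = some B, G B i ≤ 1 / 8)
    (v : F → K) (hv : ∀ B, 1 ≤ v B ∧ v B ≤ 2) :
    ∃ y : F → K, (∀ B, 1 / 4 ≤ y B ∧ y B ≤ 3) ∧ ∀ B, ∑ i, G B i * (o i).elim 1 y = v B := by
  rcases isEmpty_or_nonempty F with hF | hF
  · exact ⟨v, fun B => hF.elim B, fun B => hF.elim B⟩
  let φ : (F → K) →ₗ[K] (F → K) :=
    { toFun := fun y B => ∑ i, G B i * (o i).elim 0 y
      map_add' := by
        intro y z
        funext B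
        rw [Pi.add_apply, ← Finset.sum_add_distrib]
        refine Finset.sum_congr rfl fun i _ => ?_
        cases o i <;> simp [mul_add]
      map_smul' := by
        intro c y
        funext B
        rw [Pi.smul_apply, smul_eq_mul, Finset.mul_sum]
        refine Finset.sum_congr rfl fun i _ => ?_
        cases o i <;> simp [mul_left_comm] }
  have hφ : ∀ y B, φ y B = ∑ i, G B i * (o i).elim 0 y := fun _ _ => rfl
  have hinj : Function.Injective φ := by
    refine (injective_iff_map_eq_zero φ).mpr fun y hy => ?_
    obtain ⟨B₀, hB₀⟩ := Finite.exists_max fun B => |y B|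
    have h := abs_sum_mul_sub_le (u := fun i => (o i).elim 0 y) (c := y B₀) (Y := |y B₀|)
      (fun i => o i = some B₀) (hG B₀) (h1 B₀) (h2 B₀) (fun i hi => by simp [hi])
      (fun i => by cases hi : o i <;> simp [hB₀]) (abs_nonneg _)
    rw [← hφ, hy, Pi.zero_apply, zero_sub, abs_neg] at h
    have h0 : |y B₀| ≤ 0 := by linarith
    funext B
    exact abs_nonpos_iff.mp ((hB₀ B).trans h0)
  obtain ⟨y, hy⟩ := (LinearMap.injective_iff_surjective.mp hinj)
    (fun B => v B - ∑ i, G B i * (o i).elim 1 (fun _ => 0))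
  have hsol : ∀ B, ∑ i, G B i * (o i).elim 1 y = v B := by
    intro B
    have h := congrFun hy B
    rw [hφ, eq_sub_iff_add_eq, ← Finset.sum_add_distrib] at h
    rw [← h]
    refine Finset.sum_congr rfl fun i _ => ?_
    cases o i <;> simp
  obtain ⟨B₀, hB₀⟩ := Finite.exists_max fun B => |y B|
  have hest : ∀ B, |v B - y B| ≤ max 1 |y B₀| / 8 := by
    intro B
    rw [← hsol B]
    exact abs_sum_mul_sub_le (fun i => o i = some B) (hG B) (h1 B) (h2 B)
      (fun i hi => by simp [hi])
      (fun i => by cases hi : o i <;> simp [hB₀]) (by positivity)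
  have hY : max 1 |y B₀| ≤ 3 := by
    refine max_le (by norm_num) ?_
    have h3 := hest B₀
    have h4 : |y B₀| ≤ |v B₀| + |v B₀ - y B₀| := by
      have := abs_sub (v B₀) (v B₀ - y B₀)
      rwa [sub_sub_cancel] at this
    rw [abs_of_pos (zero_lt_one.trans_le (hv B₀).1)] at h4
    rcases le_total 1 |y B₀| with h | h
    · rw [max_eq_right h] at h3; linarith [(hv B₀).2]
    · linarith
  refine ⟨y, fun B => ?_, hsol⟩
  have h3 := abs_le.mp ((hest B).trans (by linarith : max 1 |y B₀| / 8 ≤ 3 / 8))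
  have := hv B
  constructor <;> linarith [h3.1, h3.2]

/-- A sum of finitely many series of negative valuation is small. -/
theorem sum_le_eighth {ι : Type*} (s : Finset ι) {y : ι → DualPuiseux}
    (hy : ∀ i ∈ s, dualVal (y i) < 0) : ∑ i ∈ s, y i ≤ 1 / 8 := by
  set k : DualPuiseux := ((8 * (s.card + 1) : ℕ) : DualPuiseux) with hk
  have hk0 : 0 < k := by rw [hk]; positivity
  have hkv : dualVal k⁻¹ = 0 := by rw [dualVal_inv hk0.ne', hk, dualVal_natCast, neg_zero]
  have h1 : ∑ i ∈ s, y i ≤ s.card * k⁻¹ := by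
    rw [← nsmul_eq_mul]
    exact Finset.sum_le_card_nsmul _ _ _ fun i hi =>
      (lt_of_dualVal_lt (inv_pos.mpr hk0) (by rw [hkv]; exact hy i hi)).le
  refine h1.trans ?_
  rw [← div_eq_mul_inv, div_le_div_iff₀ hk0 (by norm_num), hk]
  push_cast
  linarith

/-- Every point of `tropHyp n` in the intersection of the tropical cells of a family `T` of sites
is the valuation of a point of `puiseuxHyp n` in the intersection of the power regions of `T`. -/
theorem LiftedSites.exists_lift {n : ℕ} {L : Set (Fin n → DualPuiseux)} (hL : LiftedSites L)
    {T : Set (Fin n → DualPuiseux)} (hT : T ⊆ L) (hne : T.Nonempty) {x : Fin n → ℝ}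
    (hx0 : x ∈ tropHyp n) (hx : ∀ A ∈ T, x ∈ tropCell L A) :
    ∃ X ∈ puiseuxHyp n, dualValMap X = x ∧ ∀ A ∈ T, X ∈ powerRegion L normSq A := by
  classical
  rcases Nat.eq_zero_or_pos n with rfl | hn
  · exact ⟨0, ⟨fun i => i.elim0, by simp⟩, Subsingleton.elim _ _,
      fun A _ => zero_mem_powerRegion L A⟩
  have : Nonempty (Fin n) := ⟨⟨0, hn⟩⟩
  obtain ⟨A₀, hA₀⟩ := hne
  obtain ⟨i₀, hi₀⟩ := Finite.exists_max fun i => x i + dualVal (A₀ i)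
  set m := x i₀ + dualVal (A₀ i₀) with hm
  have hlow : ∀ B ∈ L, ∃ j, m ≤ x j + dualVal (B j) := fun B hB => hx A₀ hA₀ B hB i₀
  -- The sites whose tropical linear form takes the minimal value `m` at `x`.
  set E : Set (Fin n → DualPuiseux) := {B ∈ L | ∀ i, x i + dualVal (B i) ≤ m} with hE
  have hTE : T ⊆ E := by
    refine fun A hA => ⟨hT hA, fun i => ?_⟩
    obtain ⟨j, hj⟩ := hx A hA A₀ (hT hA₀) i
    exact hj.trans (hi₀ j)
  have hEatt : ∀ B ∈ E, ∃ j, x j + dualVal (B j) = m := by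
    intro B hB
    obtain ⟨j, hj⟩ := hlow B hB.1
    exact ⟨j, le_antisymm (hB.2 j) hj⟩
  have hEfin : E.Finite := by
    refine (hL.finite fun i => m - x i).subset fun B hB => ⟨hB.1, ?_⟩
    obtain ⟨j, hj⟩ := hEatt B hB
    exact ⟨j, by linarith⟩
  have : Finite E := hEfin
  have hpos : ∀ B : E, ∀ i, 0 < (B : Fin n → DualPuiseux) i := fun B => hL.pos B B.2.1
  -- By general position, a coordinate realizes the maximum of at most one site.
  have ho : ∀ i, ∃ o : Option E, ∀ B : E, o = some B ↔ x i + dualVal (B.1 i) = m := by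
    intro i
    by_cases h : ∃ B : E, x i + dualVal (B.1 i) = m
    · obtain ⟨B, hB⟩ := h
      refine ⟨some B, fun C => ⟨fun hC => Option.some_injective _ hC ▸ hB, fun hC => ?_⟩⟩
      exact congrArg some (Subtype.ext (hL.sep B B.2.1 C C.2.1 i (by linarith)))
    · push Not at h
      exact ⟨none, fun C => ⟨fun hC => by simp at hC, fun hC => absurd hC (h C)⟩⟩
  choose o ho using ho
  set β : (Fin n → DualPuiseux) → Fin n → DualPuiseux := fun B i => mono (x i - m) * B i with hβ
  have hβpos : ∀ B ∈ L, ∀ i, 0 < β B i := fun B hB i => mul_pos (mono_pos _) (hL.pos B hB i)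
  have hβval : ∀ B ∈ L, ∀ i, dualVal (β B i) = x i + dualVal (B i) - m := by
    intro B hB i
    rw [hβ]
    dsimp only
    rw [dualVal_mul (mono_pos _).ne' (hL.pos B hB i).ne', dualVal_mono]
    ring
  set N : E → ℕ := fun B => (Finset.univ.filter fun i => o i = some B).card with hN
  have hN0 : ∀ B, (0 : DualPuiseux) < N B := by
    intro B
    obtain ⟨j, hj⟩ := hEatt B B.2
    exact Nat.cast_pos.mpr (Finset.card_pos.mpr ⟨j, by simpa using (ho j B).mpr hj⟩)
  -- The scaling makes the block sums of the coefficient matrix equal to `1`.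
  set w : Fin n → DualPuiseux := fun i => (o i).elim 1 fun B => ((N B : DualPuiseux) * β B i)⁻¹
    with hw
  have hwB : ∀ i B, o i = some B → w i = ((N B : DualPuiseux) * β B i)⁻¹ := by
    intro i B h
    simp [hw, h]
  have hwpos : ∀ i, 0 < w i := by
    intro i
    cases h : o i with
    | none => simp [hw, h]
    | some B => rw [hwB i B h]; exact inv_pos.mpr (mul_pos (hN0 B) (hβpos B B.2.1 i))
  have hwval : ∀ i, dualVal (w i) = 0 := by
    intro i
    cases h : o i with
    | none => simp [hw, h, dualVal_one]
    | some B =>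
      rw [hwB i B h, dualVal_inv (mul_pos (hN0 B) (hβpos B B.2.1 i)).ne',
        dualVal_mul (hN0 B).ne' (hβpos B B.2.1 i).ne', dualVal_natCast, hβval B B.2.1,
        (ho i B).mp h]
      ring
  -- Sites outside `T` get the larger value `2`, so that the members of `T` become the minimizers.
  obtain ⟨y, hy, hsol⟩ := exists_block_solution o (fun (B : E) i => w i * β B i)
    (fun B i => (mul_pos (hwpos i) (hβpos B B.2.1 i)).le)
    (fun B => by
      have : ∀ i ∈ Finset.univ.filter (fun i => o i = some B),
          w i * β B i = (N B : DualPuiseux)⁻¹ := by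
        intro i hi
        rw [hwB i B (Finset.mem_filter.mp hi).2, mul_inv, mul_assoc,
          inv_mul_cancel₀ (hβpos B B.2.1 i).ne', mul_one]
      rw [Finset.sum_congr rfl this, Finset.sum_const, nsmul_eq_mul]
      exact mul_inv_cancel₀ (hN0 B).ne')
    (fun B => sum_le_eighth _ fun i hi => by
      have hi' : x i + dualVal (B.1 i) ≠ m := fun h =>
        (Finset.mem_filter.mp hi).2 ((ho i B).mpr h)
      rw [dualVal_mul (hwpos i).ne' (hβpos B B.2.1 i).ne', hwval, hβval B B.2.1]
      have := (B.2.2 i).lt_of_ne hi'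
      linarith)
    (fun B => if B.1 ∈ T then 1 else 2) (fun B => by split_ifs <;> norm_num)
  set u : Fin n → DualPuiseux := fun i => (o i).elim 1 y with hu
  have hubd : ∀ i, 1 / 4 ≤ u i ∧ u i ≤ 3 := by
    intro i
    cases h : o i with
    | none => simp only [hu, h, Option.elim_none]; norm_num
    | some B => simp only [hu, h, Option.elim_some]; exact hy B
  have hupos : ∀ i, 0 < u i := fun i => lt_of_lt_of_le (by norm_num) (hubd i).1
  have huval : ∀ i, dualVal (u i) = 0 := fun i =>
    dualVal_eq_zero_of_mem_Icc (k := 3) (l := 3)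
      (le_trans (by norm_num) (hubd i).1) ((hubd i).2.trans (by norm_num))
  set U : Fin n → DualPuiseux := fun i => w i * u i with hU
  have hUpos : ∀ i, 0 < U i := fun i => mul_pos (hwpos i) (hupos i)
  have hUval : ∀ i, dualVal (U i) = 0 := fun i => by
    rw [hU]; dsimp only
    rw [dualVal_mul (hwpos i).ne' (hupos i).ne', hwval, huval, add_zero]
  -- Only the product has to be corrected, by a common factor of valuation `0`.
  have hprodpos : 0 < ∏ i, U i := Finset.prod_pos fun i _ => hUpos i
  obtain ⟨c, hc0, hcval, hc⟩ := exists_pow_eq_of_dualVal_eq_zero (inv_pos.mpr hprodpos)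
    (by rw [dualVal_inv hprodpos.ne', dualVal_prod _ fun i _ => (hUpos i).ne']; simp [hUval])
    hn.ne'
  set X : Fin n → DualPuiseux := fun i => c * (mono (x i) * U i) with hX
  have hXpos : ∀ i, 0 < X i := fun i => mul_pos hc0 (mul_pos (mono_pos _) (hUpos i))
  have hpair : ∀ B, pairing X B = c * mono m * ∑ i, w i * β B i * u i := by
    intro B
    rw [pairing, Finset.mul_sum]
    refine Finset.sum_congr rfl fun i _ => ?_
    have h : mono (x i) = mono m * mono (x i - m) := by rw [← mono_add]; congr 1; ring
    simp only [hX, hU, hβ, h]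
    ring
  refine ⟨X, ⟨hXpos, ?_⟩, ?_, fun A hA => mem_powerRegion_iff.mpr ⟨fun i => (hXpos i).le, ?_⟩⟩
  · have hx0' : ∑ i, x i = 0 := hx0
    rw [hX, Finset.prod_mul_distrib, Finset.prod_mul_distrib, ← mono_sum, hx0', mono_zero,
      one_mul, Finset.prod_const, Finset.card_univ, Fintype.card_fin, hc,
      inv_mul_cancel₀ hprodpos.ne']
  · funext i
    change dualVal (c * (mono (x i) * U i)) = x i
    rw [dualVal_mul hc0.ne' (mul_pos (mono_pos _) (hUpos i)).ne',
      dualVal_mul (mono_pos _).ne' (hUpos i).ne', hcval, dualVal_mono, hUval]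
    ring
  · intro B hB
    rw [hpair, hpair]
    refine mul_le_mul_of_nonneg_left ?_ (mul_pos hc0 (mono_pos m)).le
    rw [hsol ⟨A, hTE hA⟩, if_pos hA]
    by_cases hBE : B ∈ E
    · rw [hsol ⟨B, hBE⟩]
      split_ifs <;> norm_num
    · -- A site outside `E` pairs to an infinitely large series.
      obtain ⟨i, hi⟩ : ∃ i, m < x i + dualVal (B i) := by
        by_contra! h
        exact hBE ⟨hB, h⟩
      have hterm : ∀ j, 0 < w j * β B j * u j := fun j =>
        mul_pos (mul_pos (hwpos j) (hβpos B hB j)) (hupos j)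
      refine le_trans (lt_of_dualVal_lt (hterm i) ?_).le
        (Finset.single_le_sum (f := fun j => w j * β B j * u j) (fun j _ => (hterm j).le)
          (Finset.mem_univ i))
      rw [dualVal_one, dualVal_mul (mul_pos (hwpos i) (hβpos B hB i)).ne' (hupos i).ne',
        dualVal_mul (hwpos i).ne' (hβpos B hB i).ne', hwval, huval, hβval B hB]
      linarith

/-! ### Comparison of the two diagrams -/

section Comparison

variable {n : ℕ} {S : Set (Fin n → ℝ)} {L : Set (Fin n → DualPuiseux)}

theorem liftedSites_of_bijOn (hgp : InGeneralPosition S) (hL : L ⊆ puiseuxHyp n)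
    (hbij : Set.BijOn dualValMap L ((fun a => -a) '' S)) : LiftedSites L where
  pos A hA := (hL hA).1
  sep A hA B hB i h := by
    obtain ⟨a, ha, hav⟩ := hbij.mapsTo hA
    obtain ⟨b, hb, hbv⟩ := hbij.mapsTo hB
    have hab : a = b := by
      by_contra hne
      refine hgp a ha b hb hne i ?_
      have h1 := congrFun hav i
      have h2 := congrFun hbv i
      simp only [Pi.neg_apply, dualValMap] at h1 h2
      linarith
    exact hbij.injOn hA hB (by rw [← hav, ← hbv, hab])

theorem neg_dualValMap_mem (hbij : Set.BijOn dualValMap L ((fun a => -a) '' S))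
    {A : Fin n → DualPuiseux} (hA : A ∈ L) : -dualValMap A ∈ S := by
  obtain ⟨a, ha, hav⟩ := hbij.mapsTo hA
  rw [← hav]
  simpa using ha

theorem exists_lifted_site (hbij : Set.BijOn dualValMap L ((fun a => -a) '' S))
    {a : Fin n → ℝ} (ha : a ∈ S) : ∃ A ∈ L, -dualValMap A = a := by
  obtain ⟨A, hA, h⟩ := hbij.surjOn ⟨a, ha, rfl⟩
  exact ⟨A, hA, by rw [h]; exact neg_neg a⟩

theorem mem_voronoiRegion_iff (hS : S ⊆ tropHyp n)
    (hbij : Set.BijOn dualValMap L ((fun a => -a) '' S)) {A : Fin n → DualPuiseux}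
    (hA : A ∈ L) {x : Fin n → ℝ} :
    x ∈ voronoiRegion S (-dualValMap A) ↔ x ∈ tropHyp n ∧ x ∈ tropCell L A := by
  refine and_congr_right fun _ => ⟨fun h B hB => ?_, fun h b hb => ?_⟩
  · have hb := neg_dualValMap_mem hbij hB
    have := (asymDist_le_iff (hS (neg_dualValMap_mem hbij hA)) (hS hb)).mp (h _ hb)
    simpa only [neg_neg] using this
  · obtain ⟨B, hB, rfl⟩ := exists_lifted_site hbij hb
    rw [asymDist_le_iff (hS (neg_dualValMap_mem hbij hA)) (hS hb), neg_neg, neg_neg]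
    exact h B hB

theorem dualValMap_mem_tropHyp {X : Fin n → DualPuiseux} (hX : X ∈ puiseuxHyp n) :
    dualValMap X ∈ tropHyp n := by
  have h := dualVal_prod Finset.univ fun i _ => (hX.1 i).ne'
  rw [hX.2, dualVal_one] at h
  exact h.symm

theorem exists_tropHyp_add_const (x : Fin n → ℝ) :
    ∃ y ∈ tropHyp n, ∃ c : ℝ, x = fun i => y i + c := by
  rcases Nat.eq_zero_or_pos n with rfl | hn
  · exact ⟨x, by simp [tropHyp], 0, by simp⟩
  · have hn' : (n : ℝ) ≠ 0 := Nat.cast_ne_zero.mpr hn.ne'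
    refine ⟨fun i => x i - (∑ j, x j) / n, ?_, (∑ j, x j) / n, by simp⟩
    change ∑ i, (x i - (∑ j, x j) / n) = 0
    rw [Finset.sum_sub_distrib, Finset.sum_const, Finset.card_univ, Fintype.card_fin,
      nsmul_eq_mul, mul_div_cancel₀ _ hn', sub_self]

/-- Tropicalization maps the cell of a family of sites in the power diagram onto the cell of the
same family in the Voronoi diagram. -/
theorem image_iInter_powerRegion (hS : S ⊆ tropHyp n) (hgp : InGeneralPosition S)
    (hL : L ⊆ puiseuxHyp n) (hbij : Set.BijOn dualValMap L ((fun a => -a) '' S))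
    {T : Set (Fin n → DualPuiseux)} (hT : T ⊆ L) (hne : T.Nonempty) :
    dualValMap '' ((⋂ A ∈ T, powerRegion L normSq A) ∩ puiseuxHyp n)
      = ⋂ A ∈ T, voronoiRegion S (-dualValMap A) := by
  have hLS := liftedSites_of_bijOn hgp hL hbij
  ext x
  simp only [Set.mem_image, Set.mem_inter_iff, Set.mem_iInter]
  constructor
  · rintro ⟨X, ⟨hX, hXH⟩, rfl⟩ A hA
    exact (mem_voronoiRegion_iff hS hbij (hT hA)).mpr
      ⟨dualValMap_mem_tropHyp hXH, hLS.dualValMap_mem (hT hA) (hX A hA) hXH.1⟩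
  · intro hx
    have hx' := fun A hA => (mem_voronoiRegion_iff hS hbij (hT hA)).mp (hx A hA)
    obtain ⟨A₀, hA₀⟩ := hne
    obtain ⟨X, hXH, hXx, hX⟩ :=
      hLS.exists_lift hT ⟨A₀, hA₀⟩ (hx' A₀ hA₀).1 fun A hA => (hx' A hA).2
    exact ⟨X, ⟨hX, hXH⟩, hXx⟩

theorem image_powerRegion_inter_posOrthant (hS : S ⊆ tropHyp n) (hgp : InGeneralPosition S)
    (hL : L ⊆ puiseuxHyp n) (hbij : Set.BijOn dualValMap L ((fun a => -a) '' S))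
    {A : Fin n → DualPuiseux} (hA : A ∈ L) :
    dualValMap '' (powerRegion L normSq A ∩ posOrthant n)
      = {x | ∃ y ∈ voronoiRegion S (-dualValMap A), ∃ c : ℝ, ∀ i, x i = y i + c} := by
  have hLS := liftedSites_of_bijOn hgp hL hbij
  ext x
  constructor
  · rintro ⟨X, ⟨hX, hXpos⟩, rfl⟩
    have hx := hLS.dualValMap_mem hA hX hXpos
    obtain ⟨y, hy, c, hc⟩ := exists_tropHyp_add_const (dualValMap X)
    refine ⟨y, (mem_voronoiRegion_iff hS hbij hA).mpr ⟨hy, ?_⟩, c, fun i => congrFun hc i⟩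
    have := tropCell_add_const hx (-c)
    rw [hc] at this
    simpa using this
  · rintro ⟨y, hy, c, hc⟩
    obtain ⟨hyH, hyA⟩ := (mem_voronoiRegion_iff hS hbij hA).mp hy
    obtain ⟨Y, hYH, hYy, hY⟩ := hLS.exists_lift (Set.singleton_subset_iff.mpr hA)
      (Set.singleton_nonempty A) hyH fun B hB => Set.mem_singleton_iff.mp hB ▸ hyA
    obtain ⟨hY0, hYA⟩ := mem_powerRegion_iff.mp (hY A rfl)
    have hpair : ∀ B, pairing (fun i => mono c * Y i) B = mono c * pairing Y B := by
      intro B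
      simp only [pairing, Finset.mul_sum, mul_assoc]
    refine ⟨fun i => mono c * Y i, ⟨mem_powerRegion_iff.mpr
      ⟨fun i => mul_nonneg (mono_pos c).le (hY0 i), fun B hB => ?_⟩,
      fun i => mul_pos (mono_pos c) (hYH.1 i)⟩, ?_⟩
    · rw [hpair, hpair]
      exact mul_le_mul_of_nonneg_left (hYA B hB) (mono_pos c).le
    · funext i
      change dualVal (mono c * Y i) = x i
      rw [dualVal_mul (mono_pos c).ne' (hYH.1 i).ne', dualVal_mono, hc i, ← hYy, add_comm]
      rfl

/-- A cell of the power diagram is determined by its tropicalization. The cell consisting of the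
origin alone lies in every other one; all other cells have a nonempty tropicalization, which
determines the family of sites. -/
theorem iInter_powerRegion_subset (hS : S ⊆ tropHyp n) (hgp : InGeneralPosition S)
    (hL : L ⊆ puiseuxHyp n) (hbij : Set.BijOn dualValMap L ((fun a => -a) '' S))
    {T T' : Set (Fin n → DualPuiseux)} (hT : T ⊆ L) (hne : T.Nonempty) (hT' : T' ⊆ L)
    (hsub : ⋂ A ∈ T, voronoiRegion S (-dualValMap A)
      ⊆ ⋂ A ∈ T', voronoiRegion S (-dualValMap A)) :
    ⋂ A ∈ T, powerRegion L normSq A ⊆ ⋂ A ∈ T', powerRegion L normSq A := by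
  have hLS := liftedSites_of_bijOn hgp hL hbij
  intro X hX
  rw [Set.mem_iInter₂] at hX ⊢
  rcases eq_or_ne X 0 with rfl | hX0
  · exact fun A _ => zero_mem_powerRegion L A
  obtain ⟨x, hx⟩ := hLS.exists_mem_tropCell hT hne hX hX0
  intro A' hA'
  refine hX A' (hLS.mem_of_iInter_subset hT hne (hT' hA') hx fun y hy => ?_)
  obtain ⟨z, hz, c, rfl⟩ := exists_tropHyp_add_const y
  have hzT : z ∈ ⋂ A ∈ T, voronoiRegion S (-dualValMap A) := by
    refine Set.mem_iInter₂.mpr fun A hA => (mem_voronoiRegion_iff hS hbij (hT hA)).mpr ⟨hz, ?_⟩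
    simpa using tropCell_add_const (hy A hA) (-c)
  exact tropCell_add_const ((mem_voronoiRegion_iff hS hbij (hT' hA')).mp
    (Set.mem_iInter₂.mp (hsub hzT) A' hA')).2 c

end Comparison

end

end TropVoronoi

theorem mainTheorem2 (n : ℕ) (S : Set (Fin n → ℝ)) (hS : S ⊆ tropHyp n) (hne : S.Nonempty)
    (hsd : SuperDiscrete S) (hgp : InGeneralPosition S)
    (L : Set (Fin n → DualPuiseux)) (hL : L ⊆ puiseuxHyp n)
    (hbij : Set.BijOn dualValMap L ((fun a => -a) '' S)) :
    (∀ A ∈ L,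
      dualValMap '' (powerRegion L normSq A ∩ puiseuxHyp n)
          = voronoiRegion S (-dualValMap A) ∧
      dualValMap '' (powerRegion L normSq A ∩ posOrthant n)
          = {x | ∃ y ∈ voronoiRegion S (-dualValMap A), ∃ c : ℝ, ∀ i, x i = y i + c}) ∧
    ∃ Φ : powerDiagram L normSq ≃o voronoiDiagram S,
      ∀ C : powerDiagram L normSq,
        (Φ C : Set (Fin n → ℝ)) = dualValMap '' ((C : Set (Fin n → DualPuiseux)) ∩ puiseuxHyp n) :=
  by
  refine ⟨fun A hA => ⟨?_, image_powerRegion_inter_posOrthant hS hgp hL hbij hA⟩, ?_⟩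
  · have h := image_iInter_powerRegion hS hgp hL hbij (Set.singleton_subset_iff.mpr hA)
      (Set.singleton_nonempty A)
    simpa using h
  · have himage : ∀ T : Set (Fin n → DualPuiseux),
        ⋂ a ∈ (fun A => -dualValMap A) '' T, voronoiRegion S a
          = ⋂ A ∈ T, voronoiRegion S (-dualValMap A) := fun T => Set.biInter_image
    let f : powerDiagram L normSq → voronoiDiagram S := fun C =>
      ⟨dualValMap '' ((C : Set (Fin n → DualPuiseux)) ∩ puiseuxHyp n), by
        obtain ⟨C, T, hT, hTne, rfl⟩ := C
        refine ⟨(fun A => -dualValMap A) '' T, ?_, hTne.image _, ?_⟩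
        · rintro _ ⟨A, hA, rfl⟩
          exact neg_dualValMap_mem hbij (hT hA)
        · rw [himage]
          exact image_iInter_powerRegion hS hgp hL hbij hT hTne⟩
    have hle : ∀ C D : powerDiagram L normSq, f C ≤ f D ↔ C ≤ D := by
      intro C D
      refine ⟨fun h => ?_, fun h => Set.image_mono (Set.inter_subset_inter_left _ h)⟩
      obtain ⟨C, T, hT, hTne, rfl⟩ := C
      obtain ⟨D, T', hT', hTne', rfl⟩ := D
      refine iInter_powerRegion_subset hS hgp hL hbij hT hTne hT' ?_
      rw [← image_iInter_powerRegion hS hgp hL hbij hT hTne,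
        ← image_iInter_powerRegion hS hgp hL hbij hT' hTne']
      exact h
    have hsurj : Function.Surjective f := by
      rintro ⟨_, T, hT, hTne, rfl⟩
      set T' : Set (Fin n → DualPuiseux) := {A ∈ L | -dualValMap A ∈ T} with hT'
      have hTT' : (fun A => -dualValMap A) '' T' = T := by
        ext a
        constructor
        · rintro ⟨A, hA, rfl⟩
          exact hA.2
        · intro ha
          obtain ⟨A, hA, rfl⟩ := exists_lifted_site hbij (hT ha)
          exact ⟨A, ⟨hA, ha⟩, rfl⟩
      have hTne' : T'.Nonempty := by rwa [← Set.image_nonempty, hTT']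
      have hTL : T' ⊆ L := fun A hA => hA.1
      refine ⟨⟨⋂ A ∈ T', powerRegion L normSq A, T', hTL, hTne', rfl⟩, Subtype.ext ?_⟩
      refine (image_iInter_powerRegion hS hgp hL hbij hTL hTne').trans ?_
      change _ = ⋂ a ∈ T, voronoiRegion S a
      rw [← himage, hTT']
    exact ⟨RelIso.ofSurjective (OrderEmbedding.ofMapLEIff f hle) hsurj, fun C => rfl⟩
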